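/- Let $\mathcal H$ be a separable complex Hilbert space (possibly finite-dimensional). A bounded operator $A$ on $\mathcal H$ is a partial isometry if $A^*A$ and $AA^*$ are self-adjoint projections, and a set of bounded operators is irreducible if its only common closed invariant subspaces are $\{0\}$ and the whole space. For $k\in\mathbb N\cup\{\infty\}$, $k\ge 1$, and a group $\mathcal U$ of unitary $r\times r$ matrices, let $\mathcal S_1^k(\mathcal U)$ be the set of bounded operators on the Hilbert space direct sum $\bigoplus_{i=1}^k\mathbb C^r$ whose $k\times k$ block matrix (with $r\times r$ blocks) has at most one non-zero block in each block row and in each block column, every non-zero block belonging to $\mathcal U$; let $\mathcal S_0^k(\mathcal U)$ be the set of those operators whose block matrix has at most one non-zero block altogether, that block belonging to $\mathcal U$. **Theorem.** Let $\mathcal S$ be an irreducible norm-closed semigroup (with respect to composition, not necessarily self-adjoint) of partial isometries on $\mathcal H$ which contains a non-zero compact operator. Then there exist $k\in\mathbb N\cup\{\infty\}$, $k\ge1$, an irreducible group $\mathcal U$ of unitary $r_0\times r_0$ matrices, where $r_0$ is the minimal rank of the non-zero operators in $\mathcal S$ (in particular, this minimum is finite), and a unitary $W:\mathcal H\to\bigoplus_{i=1}^k\mathbb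 C^{r_0}$ such that $$\mathcal S_0^k(\mathcal U)\setminus\{0\}\subseteq W\mathcal S W^{-1}\subseteq \mathcal S_1^k(\mathcal U).$$ Moreover, $\mathcal S_0^k(\mathcal U)\subseteq W\mathcal S W^{-1}$, except possibly when $k=1$ and $0\notin\mathcal S$. -/

import Mathlib

open scoped ENNReal

namespace PartialIsometrySemigroup

/-- A bounded operator `A` on a Hilbert space is a partial isometry if `A* A` and `A A*` are both
self-adjoint projections. -/
def IsPartialIsometry {H : Type*} [NormedAddCommGroup H] [InnerProductSpace ℂ H] [CompleteSpace H]
    (A : H →L[ℂ] H) : Prop :=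
  IsStarProjection (ContinuousLinearMap.adjoint A * A) ∧
    IsStarProjection (A * ContinuousLinearMap.adjoint A)

/-- A set of bounded operators is irreducible if its only common closed invariant subspaces are
the trivial ones. -/
def IsIrreducibleFamily {H : Type*} [NormedAddCommGroup H] [InnerProductSpace ℂ H]
    (S : Set (H →L[ℂ] H)) : Prop :=
  ∀ M : Submodule ℂ H, IsClosed (M : Set H) → (∀ A ∈ S, ∀ x ∈ M, A x ∈ M) → M = ⊥ ∨ M = ⊤

/-- The set of ranks (dimensions of the ranges, as cardinals) of the nonzero operators in `S`. -/
def nonzeroRanks {H : Type*} [NormedAddCommGroup H] [InnerProductSpace ℂ H]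
    (S : Set (H →L[ℂ] H)) : Set Cardinal :=
  {c | ∃ A ∈ S, A ≠ 0 ∧ (A : H →ₗ[ℂ] H).rank = c}

/-- For `k ∈ ℕ ∪ {∞}`, an index set with exactly `k` elements. -/
abbrev Index (k : ℕ∞) : Type := {i : ℕ // (i : ℕ∞) < k}

/-- `𝒮₀ᵏ`: the matrices with at most one nonzero entry, that entry being equal to one. -/
def pattern₀ (ι : Type*) : Set (Matrix ι ι ℂ) :=
  {M | (∀ i j, M i j ≠ 0 → M i j = 1) ∧
    ∀ i j i' j', M i j ≠ 0 → M i' j' ≠ 0 → i = i' ∧ j = j'}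

/-- `𝒮₁ᵏ`: the matrices with at most one nonzero entry in every row and in every column, each
such entry being equal to one. -/
def pattern₁ (ι : Type*) : Set (Matrix ι ι ℂ) :=
  {M | (∀ i j, M i j ≠ 0 → M i j = 1) ∧
    (∀ i j j', M i j ≠ 0 → M i j' ≠ 0 → j = j') ∧
    (∀ i i' j, M i j ≠ 0 → M i' j ≠ 0 → i = i')}

/-- The Hilbert space direct sum of copies of `K` indexed by `ι`. -/
abbrev DirectSumSpace (ι K : Type*) [NormedAddCommGroup K] : Type _ :=
  lp (fun _ : ι => K) 2

/-- `B` is the operator matrix of the operator `T` on the direct sum of copies of `K`: the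
`i`-th component of `T` applied to `x` placed in the `j`-th summand is `B i j x`. -/
def IsOperatorMatrix {ι K : Type*} [DecidableEq ι] [NormedAddCommGroup K] [InnerProductSpace ℂ K]
    (B : Matrix ι ι (K →L[ℂ] K)) (T : DirectSumSpace ι K →L[ℂ] DirectSumSpace ι K) : Prop :=
  ∀ i j x, T (lp.single 2 j x) i = B i j x

/-- The operators on the direct sum whose matrices are obtained from the matrices in `P` by
replacing the nonzero entries by elements of `U` and the zero entries by zero operators. -/
def inflate {ι K : Type*} [DecidableEq ι] [NormedAddCommGroup K] [InnerProductSpace ℂ K]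
    (P : Set (Matrix ι ι ℂ)) (U : Set (K →L[ℂ] K)) :
    Set (DirectSumSpace ι K →L[ℂ] DirectSumSpace ι K) :=
  {T | ∃ B : Matrix ι ι (K →L[ℂ] K), IsOperatorMatrix B T ∧
    ∃ M ∈ P, ∀ i j, (M i j = 0 → B i j = 0) ∧ (M i j ≠ 0 → B i j ∈ U)}

/-- `𝒮₀ᵏ(U)`. -/
def S₀ {K : Type*} [NormedAddCommGroup K] [InnerProductSpace ℂ K] (k : ℕ∞)
    (U : Set (K →L[ℂ] K)) :
    Set (DirectSumSpace (Index k) K →L[ℂ] DirectSumSpace (Index k) K) :=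
  inflate (pattern₀ (Index k)) U

/-- `𝒮₁ᵏ(U)`. -/
def S₁ {K : Type*} [NormedAddCommGroup K] [InnerProductSpace ℂ K] (k : ℕ∞)
    (U : Set (K →L[ℂ] K)) :
    Set (DirectSumSpace (Index k) K →L[ℂ] DirectSumSpace (Index k) K) :=
  inflate (pattern₁ (Index k)) U

/-- The operators on `ℂʳ` (with its Euclidean norm) given by the members of a group of unitary
`r × r` matrices. -/
def unitaryOperators {r : ℕ} (U : Subgroup (Matrix.unitaryGroup (Fin r) ℂ)) :
    Set (EuclideanSpace ℂ (Fin r) →L[ℂ] EuclideanSpace ℂ (Fin r)) :=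
  {A | ∃ u ∈ U, Matrix.toEuclideanCLM (n := Fin r) (𝕜 := ℂ) (u : Matrix (Fin r) (Fin r) ℂ) = A}

/-- The image `W S W⁻¹` of a set of operators under a unitary equivalence `W`. -/
def conjugate {H K : Type*} [NormedAddCommGroup H] [InnerProductSpace ℂ H] [CompleteSpace H]
    [NormedAddCommGroup K] [InnerProductSpace ℂ K] [CompleteSpace K]
    (W : H ≃ₗᵢ[ℂ] K) (S : Set (H →L[ℂ] H)) : Set (K →L[ℂ] K) :=
  W.conjStarAlgEquiv '' S

end PartialIsometrySemigroup

/-! A compact partial isometry has finite rank, so a finite minimal rank `r` exists. A non-zero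
product `B * A` of two operators of rank `r` in `S` again has rank `r`, and since all three are
partial isometries this forces `star B * B = A * star A` (`star_mul_self_eq_of_mem_rankPart`).

The crux is `star_mem_rankPart`: the rank-`r` part of `S` is self-adjoint. Irreducibility gives `T`
with `A * T * A ≠ 0`; then `A * T` acts as a unitary on the range of `A`, its adjoint is a limit of
its positive powers and so lies in `S`, and `star A = T * star (A * T)`.

Fix a projection `P` of rank `r` in `S`. Rank-`r` operators with initial projection `P` have equal
or orthogonal final projections; choose one operator `A i` for each. Their ranges span a dense
subspace by irreducibility, so the `A i` identify the space with a direct sum of copies of the range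
of `P`. The `(i, j)` block of `T` is `star (A i) * T * A j`, which lies in `S` and lives on `P`; the
non-zero operators of this kind form the group `U`. -/

namespace PartialIsometrySemigroup

/-! ### C*-algebraic identities for partial isometries and unitaries -/

section Algebra

variable {R : Type*}

theorem _root_.IsStarProjection.eq_of_mul_eq [Semigroup R] [StarMul R] {p q : R}
    (hp : IsStarProjection p) (hq : IsStarProjection q) (h₁ : p * q = p) (h₂ : q * p = q) :
    p = q := by
  have h := congrArg star h₁
  rw [star_mul, hp.isSelfAdjoint.star_eq, hq.isSelfAdjoint.star_eq, h₂] at h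
  exact h.symm

/-- With `p = star a * a`, the defect `d = a * star a * a - a` satisfies `star d * d = p³ - 2p² + p
= 0`. -/
theorem mul_star_mul_self_of_isStarProjection [NonUnitalNormedRing R] [StarRing R] [CStarRing R]
    {a : R} (h : IsStarProjection (star a * a)) : a * star a * a = a := by
  have h1 : star a * a * (star a * a) = star a * a := h.isIdempotentElem
  rw [← sub_eq_zero, ← CStarRing.star_mul_self_eq_zero_iff]
  have : star (a * star a * a - a) * (a * star a * a - a)
      = star a * a * (star a * a) * (star a * a) - star a * a * (star a * a)
        - star a * a * (star a * a) + star a * a := by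
    simp only [star_sub, star_mul, star_star]
    noncomm_ring
  rw [this, h1, h1]
  abel

/-- If `b a` is as large as `a`, then `b` is isometric on the final space of `a`. -/
theorem star_mul_self_mul_of_star_mul_self_eq [NormedRing R] [StarRing R] [CStarRing R]
    {a b : R} (hb : IsStarProjection (star b * b))
    (h : star (b * a) * (b * a) = star a * a) : star b * b * a = a := by
  have h1 : star b * b * (star b * b) = star b * b := hb.isIdempotentElem
  rw [← sub_eq_zero, ← CStarRing.star_mul_self_eq_zero_iff]
  have : star (star b * b * a - a) * (star b * b * a - a)
      = star a * (star b * b * (star b * b)) * a - star (b * a) * (b * a)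
        - star (b * a) * (b * a) + star a * a := by
    simp only [star_sub, star_mul, star_star]
    noncomm_ring
  rw [this, h1, h]
  have h2 : star a * (star b * b) * a = star (b * a) * (b * a) := by
    simp only [star_mul, mul_assoc]
  rw [h2, h]
  abel

/-- By compactness some `u ^ φ n` converge to a unitary `c`, and `star u * star (u ^ φ n) * u ^ φ (n
+ 2)` tends to `star u * star c * c = star u`. Only positive exponents are allowed because a
semigroup need not contain an identity. -/
theorem star_mem_closure_pow [NormedRing R] [StarRing R] [CStarRing R] [ProperSpace R]
    {u : R} (hu : star u * u = 1) (hu' : u * star u = 1) :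
    star u ∈ closure {v : R | ∃ n : ℕ, 1 ≤ n ∧ v = u ^ n} := by
  have hU : u ∈ unitary R := ⟨hu, hu'⟩
  have hbdd : Bornology.IsBounded (Set.range fun n : ℕ => u ^ n) := by
    rcases subsingleton_or_nontrivial R with hR | hR
    · exact (Set.toFinite _).isBounded
    · refine (isBounded_iff_forall_norm_le).2 ⟨1, ?_⟩
      rintro _ ⟨n, rfl⟩
      exact (CStarRing.norm_of_mem_unitary (pow_mem hU n)).le
  obtain ⟨c, -, φ, hφ, hc⟩ :=
    tendsto_subseq_of_bounded hbdd (x := fun n : ℕ => u ^ n) (fun n => ⟨n, rfl⟩)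
  have hpow : ∀ n, star (u ^ n) * u ^ n = 1 := fun n => (pow_mem hU n).1
  have hcc : star c * c = 1 := by
    refine tendsto_nhds_unique (hc.star.mul hc) ?_
    simp only [Function.comp_apply, hpow]
    exact tendsto_const_nhds
  -- The shift by two gives `φ (n + 2) - φ n ≥ 2`, so that the exponent stays positive after one is
  -- subtracted.
  have hc2 := hc.comp (Filter.tendsto_add_atTop_nat 2)
  have hlim := (hc.star.mul hc2).const_mul (star u)
  rw [hcc, mul_one] at hlim
  refine mem_closure_of_tendsto hlim (Filter.Eventually.of_forall fun n => ?_)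
  have h1 : φ n < φ (n + 1) := hφ (Nat.lt_succ_self n)
  have h2 : φ (n + 1) < φ (n + 2) := hφ (Nat.lt_succ_self _)
  refine ⟨φ (n + 2) - φ n - 1, by omega, ?_⟩
  obtain ⟨m, hm⟩ : ∃ m, φ (n + 2) = φ n + 1 + m := ⟨φ (n + 2) - φ n - 1, by omega⟩
  simp only [Function.comp_apply]
  rw [hm, show φ n + 1 + m - φ n - 1 = m by omega, pow_add, pow_succ, mul_assoc, ← mul_assoc _ (u ^ φ n),
    hpow, one_mul, ← mul_assoc, hu, one_mul]

end Algebra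

/-! ### Partial isometries of equal finite rank -/

section Rank

variable {H : Type*} [NormedAddCommGroup H] [InnerProductSpace ℂ H]

theorem rank_mul_le_right (B A : H →L[ℂ] H) :
    ((B * A : H →L[ℂ] H) : H →ₗ[ℂ] H).rank ≤ (A : H →ₗ[ℂ] H).rank :=
  LinearMap.rank_comp_le_right (A : H →ₗ[ℂ] H) (B : H →ₗ[ℂ] H)

theorem rank_mul_le_left (B A : H →L[ℂ] H) :
    ((B * A : H →L[ℂ] H) : H →ₗ[ℂ] H).rank ≤ (B : H →ₗ[ℂ] H).rank :=
  LinearMap.rank_comp_le_left (A : H →ₗ[ℂ] H) (B : H →ₗ[ℂ] H)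

theorem finiteDimensional_range {A : H →L[ℂ] H} {r : ℕ} (h : (A : H →ₗ[ℂ] H).rank = r) :
    FiniteDimensional ℂ (A : H →ₗ[ℂ] H).range := by
  rw [LinearMap.rank] at h
  exact Module.rank_lt_aleph0_iff.1 (h ▸ Cardinal.natCast_lt_aleph0)

theorem finrank_range {A : H →L[ℂ] H} {r : ℕ} (h : (A : H →ₗ[ℂ] H).rank = r) :
    Module.finrank ℂ (A : H →ₗ[ℂ] H).range = r :=
  Module.finrank_eq_of_rank_eq h

/-- `B` maps the range of `A` onto that of `B * A`; equal finite dimensions make this map injective.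
-/
theorem apply_eq_zero_of_rank_eq {A B : H →L[ℂ] H} {r : ℕ} (hA : (A : H →ₗ[ℂ] H).rank = r)
    (hBA : ((B * A : H →L[ℂ] H) : H →ₗ[ℂ] H).rank = r) {x : H} (hx : B (A x) = 0) : A x = 0 := by
  have := finiteDimensional_range hA
  have := finiteDimensional_range hBA
  let f : (A : H →ₗ[ℂ] H).range →ₗ[ℂ] ((B * A : H →L[ℂ] H) : H →ₗ[ℂ] H).range :=
    (B : H →ₗ[ℂ] H).restrict (by rintro _ ⟨y, rfl⟩; exact ⟨y, rfl⟩)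
  have hsurj : Function.Surjective f := by
    rintro ⟨_, y, rfl⟩
    exact ⟨⟨A y, y, rfl⟩, rfl⟩
  have hinj := (LinearMap.injective_iff_surjective_of_finrank_eq_finrank
    ((finrank_range hA).trans (finrank_range hBA).symm)).2 hsurj
  have h0 : f ⟨A x, x, rfl⟩ = 0 := Subtype.ext hx
  exact congrArg Subtype.val ((map_eq_zero_iff f hinj).1 h0)

variable [CompleteSpace H]

theorem IsPartialIsometry.star_mul_self {A : H →L[ℂ] H} (hA : IsPartialIsometry A) :
    IsStarProjection (star A * A) := hA.1

theorem IsPartialIsometry.self_mul_star {A : H →L[ℂ] H} (hA : IsPartialIsometry A) :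
    IsStarProjection (A * star A) := hA.2

theorem IsPartialIsometry.mul_star_mul {A : H →L[ℂ] H} (hA : IsPartialIsometry A) :
    A * star A * A = A :=
  mul_star_mul_self_of_isStarProjection hA.1

theorem IsPartialIsometry.star_mul_mul_star {A : H →L[ℂ] H} (hA : IsPartialIsometry A) :
    star A * A * star A = star A := by
  simpa [mul_assoc] using congrArg star hA.mul_star_mul

theorem star_mul_self_mul_eq {A B : H →L[ℂ] H} {r : ℕ} (hA : IsPartialIsometry A)
    (hBA : IsPartialIsometry (B * A)) (hrA : (A : H →ₗ[ℂ] H).rank = r)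
    (hrBA : ((B * A : H →L[ℂ] H) : H →ₗ[ℂ] H).rank = r) :
    star (B * A) * (B * A) = star A * A := by
  symm
  refine hA.star_mul_self.eq_of_mul_eq hBA.star_mul_self ?_ ?_
  · have h : (B * A) * (1 - star (B * A) * (B * A)) = 0 := by
      rw [mul_sub, mul_one, ← mul_assoc, hBA.mul_star_mul, sub_self]
    have h' : A * (1 - star (B * A) * (B * A)) = 0 := by
      ext x
      exact apply_eq_zero_of_rank_eq hrA hrBA (DFunLike.congr_fun h x)
    rw [mul_sub, mul_one, sub_eq_zero] at h'
    rw [mul_assoc, ← h']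
  · rw [mul_assoc, mul_assoc B, ← mul_assoc A, hA.mul_star_mul]

/-- Two projections of the same finite rank, one below the other, coincide. -/
theorem isStarProjection_eq_of_rank_le {P Q : H →L[ℂ] H} {r : ℕ} (hP : IsStarProjection P)
    (hQ : IsStarProjection Q) (hrP : (P : H →ₗ[ℂ] H).rank = r)
    (hrQ : (Q : H →ₗ[ℂ] H).rank ≤ r) (h : Q * P = P) : P = Q := by
  have hQr : (Q : H →ₗ[ℂ] H).rank = r :=
    le_antisymm hrQ (by rw [← hrP, ← h]; exact rank_mul_le_left _ _)
  have := finiteDimensional_range hQr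
  have hle : (P : H →ₗ[ℂ] H).range ≤ (Q : H →ₗ[ℂ] H).range := by
    rintro _ ⟨x, rfl⟩
    exact ⟨P x, DFunLike.congr_fun h x⟩
  have heq := Submodule.eq_of_le_of_finrank_eq hle
    ((finrank_range hrP).trans (finrank_range hQr).symm)
  have hPQ : P * Q = Q := by
    ext x
    obtain ⟨y, hy⟩ : Q x ∈ (P : H →ₗ[ℂ] H).range := heq ▸ ⟨x, rfl⟩
    change P (Q x) = Q x
    rw [← hy]
    exact DFunLike.congr_fun hP.isIdempotentElem y
  refine hP.eq_of_mul_eq hQ ?_ ?_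
  · simpa [hP.isSelfAdjoint.star_eq, hQ.isSelfAdjoint.star_eq] using congrArg star h
  · simpa [hP.isSelfAdjoint.star_eq, hQ.isSelfAdjoint.star_eq] using congrArg star hPQ

theorem IsPartialIsometry.rank_self_mul_star {A : H →L[ℂ] H} (hA : IsPartialIsometry A) :
    ((A * star A : H →L[ℂ] H) : H →ₗ[ℂ] H).rank = (A : H →ₗ[ℂ] H).rank :=
  le_antisymm (rank_mul_le_left _ _) <| by
    conv_lhs => rw [← hA.mul_star_mul]
    exact rank_mul_le_left _ _

/-- `B` is isometric on the range of `A`, so that range lies in the initial space of `B`; equality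
follows by comparing ranks. -/
theorem star_mul_self_eq_self_mul_star {A B : H →L[ℂ] H} {r : ℕ} (hA : IsPartialIsometry A)
    (hB : IsPartialIsometry B) (hBA : IsPartialIsometry (B * A))
    (hrA : (A : H →ₗ[ℂ] H).rank = r) (hrB : (B : H →ₗ[ℂ] H).rank = r)
    (hrBA : ((B * A : H →L[ℂ] H) : H →ₗ[ℂ] H).rank = r) : star B * B = A * star A := by
  symm
  refine isStarProjection_eq_of_rank_le hA.self_mul_star hB.star_mul_self
    (hA.rank_self_mul_star.trans hrA) ((rank_mul_le_right _ _).trans hrB.le) ?_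
  rw [← mul_assoc, star_mul_self_mul_of_star_mul_self_eq hB.star_mul_self
    (star_mul_self_mul_eq hA hBA hrA hrBA)]

/-- The compact operator `A * star A` restricts to the identity on the closed range of `A`. -/
theorem IsPartialIsometry.exists_rank_eq_of_isCompactOperator {A : H →L[ℂ] H}
    (hA : IsPartialIsometry A) (hc : IsCompactOperator A) :
    ∃ n : ℕ, (A : H →ₗ[ℂ] H).rank = n := by
  have hE : IsCompactOperator ((A * star A : H →L[ℂ] H) : H →ₗ[ℂ] H) := hc.comp_clm (star A)
  set V := ((A : H →ₗ[ℂ] H).range)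
  have hfix : ∀ x ∈ V, (A * star A) x = x := by
    rintro _ ⟨y, rfl⟩
    exact DFunLike.congr_fun hA.mul_star_mul y
  have hV : IsClosed (V : Set H) := by
    have : (V : Set H) = {x | (A * star A) x = x} :=
      Set.Subset.antisymm hfix fun x hx => ⟨star A x, hx⟩
    rw [this]
    exact isClosed_eq (A * star A).continuous continuous_id
  have hres := hE.restrict (V := V) (fun x hx => by
    change (A * star A) x ∈ V
    rw [hfix x hx]; exact hx) hV
  have hid : IsCompactOperator (id : V → V) := by
    convert hres using 1
    ext x
    exact (hfix x x.2).symm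
  have := FiniteDimensional.of_isCompactOperator_id (𝕜 := ℂ) hid
  exact ⟨Module.finrank ℂ V, (Module.finrank_eq_rank ℂ V).symm⟩

/-- The inclusion of the range of a projection of rank `r`, parametrized by `ℂʳ`. -/
theorem exists_isometry_of_isStarProjection {P : H →L[ℂ] H} {r : ℕ} (hP : IsStarProjection P)
    (hr : (P : H →ₗ[ℂ] H).rank = r) :
    ∃ J : EuclideanSpace ℂ (Fin r) →L[ℂ] H, J.adjoint ∘L J = 1 ∧ J ∘L J.adjoint = P := by
  have := finiteDimensional_range hr
  let e := ((stdOrthonormalBasis ℂ (P : H →ₗ[ℂ] H).range).reindex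
    (finCongr (finrank_range hr))).repr.symm
  let J := ((P : H →ₗ[ℂ] H).range.subtypeₗᵢ.comp e.toLinearIsometry).toContinuousLinearMap
  have hJ : J.adjoint ∘L J = 1 :=
    (ContinuousLinearMap.norm_map_iff_adjoint_comp_self J).1 fun x => e.norm_map x
  have hJJ : IsStarProjection (J ∘L J.adjoint) := by
    refine ⟨?_, ?_⟩
    · change (J ∘L J.adjoint) ∘L (J ∘L J.adjoint) = _
      rw [ContinuousLinearMap.comp_assoc, ← ContinuousLinearMap.comp_assoc _ J, hJ]
      rfl
    · rw [IsSelfAdjoint, ContinuousLinearMap.star_eq_adjoint, ContinuousLinearMap.adjoint_comp,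
        ContinuousLinearMap.adjoint_adjoint]
  have h1 : P * (J ∘L J.adjoint) = J ∘L J.adjoint := by
    ext x
    obtain ⟨y, hy⟩ := (e (J.adjoint x)).2
    change P (e (J.adjoint x)) = e (J.adjoint x)
    rw [← hy]
    exact DFunLike.congr_fun hP.isIdempotentElem y
  have h2 : (J ∘L J.adjoint) * P = P := by
    ext x
    have hx : J (e.symm ⟨P x, x, rfl⟩) = P x := by simp [J]
    change J (J.adjoint (P x)) = P x
    rw [← hx]
    exact congrArg J (DFunLike.congr_fun hJ _)
  refine ⟨J, hJ, hJJ.eq_of_mul_eq hP ?_ ?_⟩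
  · simpa [hP.isSelfAdjoint.star_eq, hJJ.isSelfAdjoint.star_eq] using congrArg star h1
  · simpa [hP.isSelfAdjoint.star_eq, hJJ.isSelfAdjoint.star_eq] using congrArg star h2

end Rank

/-! ### Operators supported on the range of an isometry -/

section Corner

variable {H K : Type*} [NormedAddCommGroup H] [InnerProductSpace ℂ H] [CompleteSpace H]
  [NormedAddCommGroup K] [InnerProductSpace ℂ K] [CompleteSpace K]

/-- The operator on `H` that acts as `y` on the range of the isometry `J` and vanishes on its
orthogonal complement. -/
noncomputable def corner (J : K →L[ℂ] H) (y : K →L[ℂ] K) : H →L[ℂ] H :=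
  J ∘L y ∘L J.adjoint

theorem continuous_corner (J : K →L[ℂ] H) : Continuous (corner J) :=
  continuous_const.clm_comp (continuous_id.clm_comp continuous_const)

theorem corner_one (J : K →L[ℂ] H) : corner J 1 = J ∘L J.adjoint := rfl

theorem corner_mul {J : K →L[ℂ] H} (hJ : J.adjoint ∘L J = 1) (y z : K →L[ℂ] K) :
    corner J (y * z) = corner J y * corner J z := by
  ext x
  have h := DFunLike.congr_fun hJ (z (J.adjoint x))
  exact congrArg (fun w => J (y w)) h.symm

theorem corner_star (J : K →L[ℂ] H) (y : K →L[ℂ] K) : corner J (star y) = star (corner J y) := by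
  simp only [corner, ContinuousLinearMap.star_eq_adjoint, ContinuousLinearMap.adjoint_comp,
    ContinuousLinearMap.adjoint_adjoint]
  rfl

theorem adjoint_comp_corner_comp {J : K →L[ℂ] H} (hJ : J.adjoint ∘L J = 1) (y : K →L[ℂ] K) :
    J.adjoint ∘L corner J y ∘L J = y := by
  ext x
  have h (z : K) : J.adjoint (J z) = z := DFunLike.congr_fun hJ z
  change J.adjoint (J (y (J.adjoint (J x)))) = y x
  rw [h, h]

theorem corner_injective {J : K →L[ℂ] H} (hJ : J.adjoint ∘L J = 1) :
    Function.Injective (corner J) := fun y z h => by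
  rw [← adjoint_comp_corner_comp hJ y, h, adjoint_comp_corner_comp hJ z]

/-- An operator living on the final space of `J` comes from an operator on `K`. -/
theorem exists_corner_eq {J : K →L[ℂ] H} {P T : H →L[ℂ] H} (hJP : J ∘L J.adjoint = P)
    (h₁ : P * T = T) (h₂ : T * P = T) : ∃ y, corner J y = T := by
  refine ⟨J.adjoint ∘L T ∘L J, ?_⟩
  conv_rhs => rw [← h₁, ← h₂, ← hJP]
  rfl

theorem corner_pow_mem {J : K →L[ℂ] H} (hJ : J.adjoint ∘L J = 1) {S : Subsemigroup (H →L[ℂ] H)}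
    {y : K →L[ℂ] K} (hy : corner J y ∈ S) {n : ℕ} (hn : 1 ≤ n) : corner J (y ^ n) ∈ S := by
  induction n, hn using Nat.le_induction with
  | base => rwa [pow_one]
  | succ n _ ih => rw [pow_succ, corner_mul hJ]; exact S.mul_mem ih hy

end Corner

/-! ### Operators of minimal rank in an irreducible semigroup -/

section Semigroup

variable {H : Type*} [NormedAddCommGroup H] [InnerProductSpace ℂ H]

/-- The vectors killed by every `C ∘L T` form a closed invariant subspace. If it is everything, all
ranges lie in the kernel of `C`, which is then itself invariant; so either `S` or `C` vanishes. -/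
theorem exists_apply_ne_zero {F : Type*} [NormedAddCommGroup F] [InnerProductSpace ℂ F]
    {S : Subsemigroup (H →L[ℂ] H)} (hirr : IsIrreducibleFamily (S : Set (H →L[ℂ] H)))
    (hS : ∃ A ∈ S, A ≠ 0) {C : H →L[ℂ] F} (hC : C ≠ 0) {x : H} (hx : x ≠ 0) :
    ∃ T ∈ S, C (T x) ≠ 0 := by
  by_contra! hcon
  let M : Submodule ℂ H := ⨅ T : S, (C ∘L T.1 : H →L[ℂ] F).ker
  have hM (y : H) : y ∈ M ↔ ∀ T ∈ S, C (T y) = 0 := by simp [M, Submodule.mem_iInf]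
  have hMclosed : IsClosed (M : Set H) := by
    have : (M : Set H) = ⋂ T : S, ((C ∘L T.1 : H →L[ℂ] F).ker : Set H) := Submodule.coe_iInf _
    rw [this]
    exact isClosed_iInter fun T => (C ∘L T.1).isClosed_ker
  rcases hirr M hMclosed
    (fun A hA y hy => (hM _).2 fun T hT => (hM y).1 hy (T * A) (S.mul_mem hT hA)) with h | h
  · exact hx ((Submodule.mem_bot ℂ).1 (h ▸ (hM x).2 hcon))
  · have hCT : ∀ T ∈ S, ∀ y, C (T y) = 0 := fun T hT y =>
      (hM y).1 (h ▸ Submodule.mem_top) T hT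
    rcases hirr C.ker C.isClosed_ker (fun A hA y _ => hCT A hA y) with h | h
    · obtain ⟨A, hA, hA0⟩ := hS
      refine hA0 (ContinuousLinearMap.ext fun y => ?_)
      have : A y ∈ C.ker := hCT A hA y
      rwa [h, Submodule.mem_bot] at this
    · refine hC (ContinuousLinearMap.ext fun y => ?_)
      have : y ∈ C.ker := h ▸ Submodule.mem_top
      exact this

/-- The nonzero operators of rank `r` in `S`; `r` will be the minimal nonzero rank. -/
def rankPart (S : Subsemigroup (H →L[ℂ] H)) (r : ℕ) : Set (H →L[ℂ] H) :=
  {A | A ∈ S ∧ A ≠ 0 ∧ (A : H →ₗ[ℂ] H).rank = r}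

variable {S : Subsemigroup (H →L[ℂ] H)} {r : ℕ}

theorem mem_rankPart_of_rank_le
    (hr : IsLeast (nonzeroRanks (S : Set (H →L[ℂ] H))) r) {A : H →L[ℂ] H} (hA : A ∈ S)
    (h0 : A ≠ 0) (h : (A : H →ₗ[ℂ] H).rank ≤ r) : A ∈ rankPart S r :=
  ⟨hA, h0, le_antisymm h (hr.2 ⟨A, hA, h0, rfl⟩)⟩

theorem mul_mem_rankPart_of_right
    (hr : IsLeast (nonzeroRanks (S : Set (H →L[ℂ] H))) r) {A T : H →L[ℂ] H} (hT : T ∈ S)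
    (hA : A ∈ rankPart S r) (h : T * A ≠ 0) : T * A ∈ rankPart S r :=
  mem_rankPart_of_rank_le hr (S.mul_mem hT hA.1) h ((rank_mul_le_right _ _).trans hA.2.2.le)

theorem mul_mem_rankPart_of_left
    (hr : IsLeast (nonzeroRanks (S : Set (H →L[ℂ] H))) r) {A T : H →L[ℂ] H} (hT : T ∈ S)
    (hA : A ∈ rankPart S r) (h : A * T ≠ 0) : A * T ∈ rankPart S r :=
  mem_rankPart_of_rank_le hr (S.mul_mem hA.1 hT) h ((rank_mul_le_left _ _).trans hA.2.2.le)

theorem exists_mul_mul_ne_zero (hirr : IsIrreducibleFamily (S : Set (H →L[ℂ] H)))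
    {A : H →L[ℂ] H} (hA : A ∈ rankPart S r) : ∃ T ∈ S, A * T * A ≠ 0 := by
  obtain ⟨x, hx⟩ : ∃ x, A x ≠ 0 := by
    by_contra! h
    exact hA.2.1 (ContinuousLinearMap.ext h)
  obtain ⟨T, hT, h⟩ := exists_apply_ne_zero hirr ⟨A, hA.1, hA.2.1⟩ hA.2.1 hx
  exact ⟨T, hT, fun h0 => h (DFunLike.congr_fun h0 x)⟩

variable [CompleteSpace H]

theorem exists_isLeast_nonzeroRanks (hpi : ∀ A ∈ S, IsPartialIsometry A)
    (hcompact : ∃ A ∈ S, A ≠ 0 ∧ IsCompactOperator A) :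
    ∃ r : ℕ, IsLeast (nonzeroRanks (S : Set (H →L[ℂ] H))) r := by
  classical
  have hex : ∃ n : ℕ, ∃ A ∈ S, A ≠ 0 ∧ (A : H →ₗ[ℂ] H).rank = n := by
    obtain ⟨A, hA, h0, hc⟩ := hcompact
    obtain ⟨n, hn⟩ := (hpi A hA).exists_rank_eq_of_isCompactOperator hc
    exact ⟨n, A, hA, h0, hn⟩
  refine ⟨Nat.find hex, Nat.find_spec hex, ?_⟩
  rintro _ ⟨A, hA, h0, rfl⟩
  rcases lt_or_ge (A : H →ₗ[ℂ] H).rank Cardinal.aleph0 with h | h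
  · obtain ⟨n, hn⟩ := Cardinal.lt_aleph0.1 h
    rw [hn, Nat.cast_le]
    exact Nat.find_min' hex ⟨A, hA, h0, hn⟩
  · exact Cardinal.natCast_le_aleph0.trans h

theorem star_mul_mul_self_eq_of_mem_rankPart (hpi : ∀ A ∈ S, IsPartialIsometry A)
    (hr : IsLeast (nonzeroRanks (S : Set (H →L[ℂ] H))) r) {A T : H →L[ℂ] H} (hT : T ∈ S)
    (hA : A ∈ rankPart S r) (h : T * A ≠ 0) : star (T * A) * (T * A) = star A * A :=
  have hTA := mul_mem_rankPart_of_right hr hT hA h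
  star_mul_self_mul_eq (hpi A hA.1) (hpi _ hTA.1) hA.2.2 hTA.2.2

/-- If the product of two operators of minimal rank does not vanish, then the initial space of the
left one is the final space of the right one. -/
theorem star_mul_self_eq_of_mem_rankPart (hpi : ∀ A ∈ S, IsPartialIsometry A)
    (hr : IsLeast (nonzeroRanks (S : Set (H →L[ℂ] H))) r) {A B : H →L[ℂ] H}
    (hA : A ∈ rankPart S r) (hB : B ∈ rankPart S r) (h : B * A ≠ 0) :
    star B * B = A * star A :=
  have hBA := mul_mem_rankPart_of_right hr hB.1 hA h
  star_mul_self_eq_self_mul_star (hpi A hA.1) (hpi B hB.1) (hpi _ hBA.1) hA.2.2 hB.2.2 hBA.2.2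

/-- Compressed to `ℂʳ`, `B` is a unitary on a finite-dimensional space, so `star_mem_closure_pow`
applies and `corner J` carries the limit back to `S`. -/
theorem star_mem_of_unitary_on_final_space (hclosed : IsClosed (S : Set (H →L[ℂ] H)))
    {B P : H →L[ℂ] H} (hB : B ∈ S) (hpB : IsPartialIsometry B)
    (hrB : (B : H →ₗ[ℂ] H).rank = r) (h₁ : B * star B = P) (h₂ : star B * B = P) : star B ∈ S := by
  obtain ⟨J, hJ, hJP⟩ := exists_isometry_of_isStarProjection hpB.self_mul_star
    (hpB.rank_self_mul_star.trans hrB)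
  rw [h₁] at hJP
  have hPB : P * B = B := by rw [← h₁, hpB.mul_star_mul]
  have hBP : B * P = B := by rw [← h₂, ← mul_assoc, hpB.mul_star_mul]
  obtain ⟨b, rfl⟩ := exists_corner_eq hJP hPB hBP
  rw [← corner_star, ← corner_mul hJ, ← hJP, ← corner_one] at h₁ h₂
  have := FiniteDimensional.proper ℂ
    (EuclideanSpace ℂ (Fin r) →L[ℂ] EuclideanSpace ℂ (Fin r))
  have hmem := star_mem_closure_pow (corner_injective hJ h₂) (corner_injective hJ h₁)
  rw [← corner_star]
  have hcl : corner J (star b) ∈ closure (S : Set (H →L[ℂ] H)) :=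
    map_mem_closure (continuous_corner J) hmem (by
      rintro _ ⟨n, hn, rfl⟩
      exact corner_pow_mem hJ hB hn)
  rwa [hclosed.closure_eq] at hcl

/-- In an irreducible closed semigroup of partial isometries, the operators of minimal rank form a
self-adjoint family. -/
theorem star_mem_rankPart (hpi : ∀ A ∈ S, IsPartialIsometry A)
    (hirr : IsIrreducibleFamily (S : Set (H →L[ℂ] H))) (hclosed : IsClosed (S : Set (H →L[ℂ] H)))
    (hr : IsLeast (nonzeroRanks (S : Set (H →L[ℂ] H))) r) {A : H →L[ℂ] H}
    (hA : A ∈ rankPart S r) : star A ∈ rankPart S r := by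
  have hpA := hpi A hA.1
  obtain ⟨T, hT, h0⟩ := exists_mul_mul_ne_zero hirr hA
  have hB : A * T ∈ rankPart S r :=
    mul_mem_rankPart_of_left hr hT hA fun h => h0 (by rw [h, zero_mul])
  have hpB := hpi _ hB.1
  have h₂ : star (A * T) * (A * T) = A * star A := star_mul_self_eq_of_mem_rankPart hpi hr hA hB h0
  have h₁ : A * T * star (A * T) = A * star A :=
    isStarProjection_eq_of_rank_le hpB.self_mul_star hpA.self_mul_star
      (hpB.rank_self_mul_star.trans hB.2.2) (hpA.rank_self_mul_star.trans hA.2.2).le (by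
        rw [← mul_assoc, ← mul_assoc, hpA.mul_star_mul])
  have hBs := star_mem_of_unitary_on_final_space hclosed hB.1 hpB hB.2.2 h₁ h₂
  -- `D = T * star (A * T)` is a right inverse of `A` on its final space.
  have hAD : A * (T * star (A * T)) = A * star A := by rw [← mul_assoc, h₁]
  have hD0 : T * star (A * T) ≠ 0 := fun h => by
    rw [h, mul_zero] at hAD
    apply hA.2.1
    rw [← hpA.mul_star_mul, ← hAD, zero_mul]
  have hDS := S.mul_mem hT hBs
  have hD : T * star (A * T) ∈ rankPart S r := by
    refine mem_rankPart_of_rank_le hr hDS hD0 ((rank_mul_le_right _ _).trans ?_)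
    rw [← hpB.star_mul_mul_star, mul_assoc]
    exact ((rank_mul_le_right _ _).trans hpB.rank_self_mul_star.le).trans hB.2.2.le
  have hne : A * (T * star (A * T)) ≠ 0 := by
    rw [hAD]
    intro h
    apply hA.2.1
    rw [← hpA.mul_star_mul, h, zero_mul]
  -- Now `star A * A = D * star D`, whence `star A = star A * A * D = D * star D * D = D`.
  have h3 := star_mul_self_eq_of_mem_rankPart hpi hr hD hA hne
  have h4 : star A = T * star (A * T) := by
    calc star A = star A * A * star A := hpA.star_mul_mul_star.symm
      _ = star A * A * (T * star (A * T)) := by rw [mul_assoc, ← hAD, ← mul_assoc]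
      _ = T * star (A * T) := by rw [h3, (hpi _ hDS).mul_star_mul]
  rw [h4]
  exact hD

theorem self_mul_star_mem_rankPart (hpi : ∀ A ∈ S, IsPartialIsometry A)
    (hirr : IsIrreducibleFamily (S : Set (H →L[ℂ] H))) (hclosed : IsClosed (S : Set (H →L[ℂ] H)))
    (hr : IsLeast (nonzeroRanks (S : Set (H →L[ℂ] H))) r) {A : H →L[ℂ] H}
    (hA : A ∈ rankPart S r) : A * star A ∈ rankPart S r := by
  refine mul_mem_rankPart_of_left hr (star_mem_rankPart hpi hirr hclosed hr hA).1 hA fun h => ?_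
  apply hA.2.1
  rw [← (hpi A hA.1).mul_star_mul, h, zero_mul]

end Semigroup

/-! ### Hilbert sums and operator matrices -/

section Sum

theorem exists_index_equiv (ι : Type*) [Countable ι] [Nonempty ι] :
    ∃ k : ℕ∞, 1 ≤ k ∧ Nonempty (Index k ≃ ι) := by
  rcases finite_or_infinite ι with h | h
  · refine ⟨Nat.card ι, by exact_mod_cast Nat.card_pos, ⟨?_⟩⟩
    refine (Equiv.subtypeEquivRight fun i => ?_).trans
      (Fin.equivSubtype.symm.trans (Finite.equivFin ι).symm)
    exact Nat.cast_lt
  · obtain ⟨_⟩ := nonempty_denumerable ι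
    exact ⟨⊤, le_top, ⟨(Equiv.subtypeUnivEquiv fun i => ENat.natCast_lt_top i).trans
      (Denumerable.eqv ι).symm⟩⟩

theorem operator_eq_of_isOperatorMatrix {ι K : Type*} [DecidableEq ι]
    [NormedAddCommGroup K] [InnerProductSpace ℂ K] {B : Matrix ι ι (K →L[ℂ] K)}
    {T T' : DirectSumSpace ι K →L[ℂ] DirectSumSpace ι K} (h : IsOperatorMatrix B T)
    (h' : IsOperatorMatrix B T') : T = T' := by
  refine lp.ext_continuousLinearMap ENNReal.ofNat_ne_top fun j => ?_
  ext x i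
  exact (h i j x).trans (h' i j x).symm

variable {ι H K : Type*} [NormedAddCommGroup H] [InnerProductSpace ℂ H] [CompleteSpace H]
  [NormedAddCommGroup K] [InnerProductSpace ℂ K] [CompleteSpace K]

theorem inner_apply_apply_of_adjoint_comp {F : Type*} [NormedAddCommGroup F]
    [InnerProductSpace ℂ F] [CompleteSpace F] {V W : F →L[ℂ] H} {C : F →L[ℂ] F}
    (h : V.adjoint ∘L W = C) (x y : F) : inner ℂ (V x) (W y) = inner ℂ x (C y) := by
  rw [← ContinuousLinearMap.adjoint_inner_right, ← h]
  rfl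

/-- The images of one unit vector are at mutual distance at least 1, so the balls of radius 1/2
around them are disjoint, and separability applies. -/
theorem countable_of_adjoint_comp_eq_zero [TopologicalSpace.SeparableSpace H] [Nontrivial K]
    {V : ι → K →L[ℂ] H} (h₁ : ∀ i, (V i).adjoint ∘L V i = 1)
    (h₀ : ∀ i j, i ≠ j → (V i).adjoint ∘L V j = 0) : Countable ι := by
  obtain ⟨x, hx⟩ := exists_norm_eq K zero_le_one
  have hnorm (i : ι) : ‖V i x‖ = 1 := by
    rw [(ContinuousLinearMap.norm_map_iff_adjoint_comp_self (V i)).2 (h₁ i), hx]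
  have hdist (i j : ι) (hij : i ≠ j) : 1 ≤ dist (V i x) (V j x) := by
    have h : inner ℂ (V i x) (V i x - V j x) = 1 := by
      rw [inner_sub_right, inner_self_eq_norm_sq_to_K, hnorm,
        inner_apply_apply_of_adjoint_comp (h₀ i j hij)]
      simp
    have h' := norm_inner_le_norm (𝕜 := ℂ) (V i x) (V i x - V j x)
    rw [h, hnorm, norm_one, one_mul] at h'
    rwa [dist_eq_norm]
  have hdisj : Set.PairwiseDisjoint (Set.univ : Set ι)
      fun i => Metric.ball (V i x) (1 / 2 : ℝ) := by
    intro i _ j _ hij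
    refine Metric.ball_disjoint_ball ?_
    linarith [hdist i j hij]
  rw [← Set.countable_univ_iff]
  exact hdisj.countable_of_isOpen (fun i _ => Metric.isOpen_ball)
    fun i _ => Metric.nonempty_ball.2 (by norm_num)

/-- A decomposition of `H` into pairwise orthogonal isometric images of `K` identifies `H` with a
direct sum of copies of `K`. -/
theorem exists_isometryEquiv_directSumSpace [DecidableEq ι] {V : ι → K →L[ℂ] H}
    (h₁ : ∀ i, (V i).adjoint ∘L V i = 1) (h₀ : ∀ i j, i ≠ j → (V i).adjoint ∘L V j = 0)
    (htotal : (⨆ i, (V i : K →ₗ[ℂ] H).range).topologicalClosure = ⊤) :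
    ∃ W : H ≃ₗᵢ[ℂ] DirectSumSpace ι K,
      (∀ i x, W.symm (lp.single 2 i x) = V i x) ∧ ∀ y i, W y i = (V i).adjoint y := by
  let V' (i : ι) : K →ₗᵢ[ℂ] H := ⟨(V i : K →ₗ[ℂ] H),
    (ContinuousLinearMap.norm_map_iff_adjoint_comp_self (V i)).2 (h₁ i)⟩
  have hortho : OrthogonalFamily ℂ (fun _ : ι => K) V' := fun i j hij x y => by
    have h : inner ℂ (V i x) (V j y) = 0 := by
      rw [inner_apply_apply_of_adjoint_comp (h₀ i j hij)]
      simp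
    exact h
  have hsum : IsHilbertSum ℂ (fun _ : ι => K) V' := IsHilbertSum.mk hortho htotal.ge
  have hsingle (i : ι) (x : K) : hsum.linearIsometryEquiv.symm (lp.single 2 i x) = V i x :=
    hsum.linearIsometryEquiv_symm_apply_single x
  refine ⟨hsum.linearIsometryEquiv, hsingle, fun y i => ?_⟩
  refine ext_inner_left ℂ fun x => ?_
  rw [ContinuousLinearMap.adjoint_inner_right, ← hsingle, ← lp.inner_single_left (𝕜 := ℂ)
    (G := fun _ : ι => K), ← LinearIsometryEquiv.inner_map_map hsum.linearIsometryEquiv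
      (hsum.linearIsometryEquiv.symm _), LinearIsometryEquiv.apply_symm_apply]

theorem isOperatorMatrix_conjStarAlgEquiv [DecidableEq ι] {V : ι → K →L[ℂ] H}
    {W : H ≃ₗᵢ[ℂ] DirectSumSpace ι K} (hW : ∀ i x, W.symm (lp.single 2 i x) = V i x)
    (hW' : ∀ y i, W y i = (V i).adjoint y) (T : H →L[ℂ] H) :
    IsOperatorMatrix (fun i j => (V i).adjoint ∘L T ∘L V j) (W.conjStarAlgEquiv T) := by
  intro i j x
  rw [LinearIsometryEquiv.conjStarAlgEquiv_apply_apply, hW, hW']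
  rfl

end Sum

/-! ### The orthogonal decomposition and the unitary group -/

section Structure

variable {H : Type*} [NormedAddCommGroup H] [InnerProductSpace ℂ H] [CompleteSpace H]
  {S : Subsemigroup (H →L[ℂ] H)} {r : ℕ} {P : H →L[ℂ] H}

theorem adjoint_comp_comp_comp {K : Type*} [NormedAddCommGroup K] [InnerProductSpace ℂ K]
    [CompleteSpace K] (J : K →L[ℂ] H) (A T B : H →L[ℂ] H) :
    (A ∘L J).adjoint ∘L T ∘L (B ∘L J) = J.adjoint ∘L (star A * T * B) ∘L J := by
  rw [ContinuousLinearMap.adjoint_comp]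
  rfl

theorem adjoint_comp_comp {K : Type*} [NormedAddCommGroup K] [InnerProductSpace ℂ K]
    [CompleteSpace K] (J : K →L[ℂ] H) (A B : H →L[ℂ] H) :
    (A ∘L J).adjoint ∘L (B ∘L J) = J.adjoint ∘L (star A * B) ∘L J := by
  rw [ContinuousLinearMap.adjoint_comp]
  rfl

theorem adjoint_comp_proj_comp {K : Type*} [NormedAddCommGroup K] [InnerProductSpace ℂ K]
    [CompleteSpace K] {J : K →L[ℂ] H} (hJ : J.adjoint ∘L J = 1) (hJP : J ∘L J.adjoint = P) :
    J.adjoint ∘L P ∘L J = 1 := by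
  rw [← hJP, ← corner_one, adjoint_comp_corner_comp hJ]

theorem mul_eq_self_of_star_mul_self_eq {A : H →L[ℂ] H} (hA : IsPartialIsometry A)
    (h : star A * A = P) : A * P = A := by
  rw [← h, ← mul_assoc, hA.mul_star_mul]

/-- Partial isometries in `S` from the range of `P` onto the members of an orthogonal family of
subspaces, which is exhaustive among the ranges of operators of minimal rank starting at `P`. -/
theorem exists_orthogonal_family [TopologicalSpace.SeparableSpace H]
    (hpi : ∀ A ∈ S, IsPartialIsometry A)
    (hirr : IsIrreducibleFamily (S : Set (H →L[ℂ] H))) (hclosed : IsClosed (S : Set (H →L[ℂ] H)))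
    (hr : IsLeast (nonzeroRanks (S : Set (H →L[ℂ] H))) r)
    (hP : IsStarProjection P) (hPr : P ∈ rankPart S r) :
    ∃ k : ℕ∞, 1 ≤ k ∧ ∃ A : Index k → H →L[ℂ] H, (∀ i, A i ∈ rankPart S r) ∧
      (∀ i, star (A i) * A i = P) ∧ (∀ i j, i ≠ j → star (A i) * A j = 0) ∧
      ∀ B ∈ rankPart S r, star B * B = P → ∃ i, B * star B = A i * star (A i) := by
  -- Indexing by final projections rather than by operators makes distinct indices orthogonal.
  let ι : Type _ := {E : H →L[ℂ] H // ∃ A ∈ rankPart S r, star A * A = P ∧ A * star A = E}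
  choose A hA hAP hAE using fun e : ι => e.2
  have horth (i j : ι) (hij : i ≠ j) : star (A i) * A j = 0 := by
    by_contra h
    have := star_mul_self_eq_of_mem_rankPart hpi hr (hA j)
      (star_mem_rankPart hpi hirr hclosed hr (hA i)) h
    rw [star_star, hAE, hAE] at this
    exact hij (Subtype.ext this)
  obtain ⟨J, hJ, hJP⟩ := exists_isometry_of_isStarProjection hP hPr.2.2
  have : Nontrivial (EuclideanSpace ℂ (Fin r)) := by
    by_contra h
    rw [not_nontrivial_iff_subsingleton] at h
    refine hPr.2.1 ?_
    rw [← hJP, Subsingleton.elim J 0, ContinuousLinearMap.zero_comp]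
  have : Countable ι := by
    refine countable_of_adjoint_comp_eq_zero (V := fun i => A i ∘L J) (fun i => ?_)
      fun i j hij => ?_
    · rw [adjoint_comp_comp, hAP, adjoint_comp_proj_comp hJ hJP]
    · rw [adjoint_comp_comp, horth i j hij, ContinuousLinearMap.zero_comp,
        ContinuousLinearMap.comp_zero]
  have : Nonempty ι := ⟨⟨P * star P, P, hPr, by
    rw [hP.isSelfAdjoint.star_eq]; exact hP.isIdempotentElem, rfl⟩⟩
  obtain ⟨k, hk, ⟨e⟩⟩ := exists_index_equiv ι
  refine ⟨k, hk, fun i => A (e i), fun i => hA _, fun i => hAP _,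
    fun i j hij => horth _ _ (e.injective.ne hij), fun B hB hBP => ?_⟩
  refine ⟨e.symm ⟨B * star B, B, hB, hBP, rfl⟩, ?_⟩
  rw [hAE, e.apply_symm_apply]

/-- The images of the range of `P` under the operators of an exhaustive family span a dense
subspace. -/
theorem topologicalClosure_iSup_range_eq_top {ι K : Type*} [NormedAddCommGroup K]
    [InnerProductSpace ℂ K] [CompleteSpace K] [Nonempty ι] {J : K →L[ℂ] H}
    (hJP : J ∘L J.adjoint = P) (hpi : ∀ A ∈ S, IsPartialIsometry A)
    (hirr : IsIrreducibleFamily (S : Set (H →L[ℂ] H)))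
    (hr : IsLeast (nonzeroRanks (S : Set (H →L[ℂ] H))) r) {A : ι → H →L[ℂ] H}
    (hA : ∀ i, A i ∈ rankPart S r) (hAP : ∀ i, star (A i) * A i = P)
    (hex : ∀ B ∈ rankPart S r, star B * B = P → ∃ i, B * star B = A i * star (A i)) :
    (⨆ i, ((A i ∘L J : K →L[ℂ] H) : K →ₗ[ℂ] H).range).topologicalClosure = ⊤ := by
  set N : Submodule ℂ H := ⨆ i, ((A i ∘L J : K →L[ℂ] H) : K →ₗ[ℂ] H).range
  have hmem (i : ι) (x : K) : A i (J x) ∈ N := Submodule.mem_iSup_of_mem i ⟨x, rfl⟩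
  have hinv : ∀ T ∈ S, ∀ x ∈ N, T x ∈ N := by
    intro T hT
    suffices N ≤ N.comap (T : H →ₗ[ℂ] H) from this
    refine iSup_le fun j => ?_
    rintro _ ⟨x, rfl⟩
    change (T * A j) (J x) ∈ N
    by_cases h : T * A j = 0
    · simp [h]
    · have hTA := mul_mem_rankPart_of_right hr hT (hA j) h
      obtain ⟨i, hi⟩ := hex _ hTA
        ((star_mul_mul_self_eq_of_mem_rankPart hpi hr hT (hA j) h).trans (hAP j))
      -- `T * A j` has initial projection `P`, so its final projection is that of some `A i`, and
      -- its values lie in the range of `A i ∘L J`.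
      have heq : T * A j = A i * (J ∘L J.adjoint) * star (A i) * (T * A j) := by
        rw [hJP, mul_eq_self_of_star_mul_self_eq (hpi _ (hA i).1) (hAP i), ← hi,
          (hpi _ hTA.1).mul_star_mul]
      rw [heq]
      exact hmem i _
  refine (hirr N.topologicalClosure N.isClosed_topologicalClosure fun T hT x hx =>
    map_mem_closure T.continuous hx (hinv T hT)).resolve_left fun hbot => ?_
  obtain ⟨i⟩ := ‹Nonempty ι›
  refine (hA i).2.1 ?_
  have hz (x : K) : A i (J x) = 0 := by
    have h := N.le_topologicalClosure (hmem i x)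
    rwa [hbot, Submodule.mem_bot] at h
  rw [← mul_eq_self_of_star_mul_self_eq (hpi _ (hA i).1) (hAP i), ← hJP]
  exact ContinuousLinearMap.ext fun x => hz _

theorem corner_mem_rankPart {K : Type*} [NormedAddCommGroup K] [InnerProductSpace ℂ K]
    [CompleteSpace K] {J : K →L[ℂ] H} (hJ : J.adjoint ∘L J = 1) (hJP : J ∘L J.adjoint = P)
    (hr : IsLeast (nonzeroRanks (S : Set (H →L[ℂ] H))) r) (hPr : P ∈ rankPart S r)
    {C : K →L[ℂ] K} (hC : corner J C ∈ S) (h0 : C ≠ 0) : corner J C ∈ rankPart S r := by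
  refine mem_rankPart_of_rank_le hr hC (fun h => h0 (corner_injective hJ (h.trans ?_))) ?_
  · simp [corner]
  · rw [← one_mul C, corner_mul hJ, corner_one, hJP]
    exact (rank_mul_le_left _ _).trans hPr.2.2.le

/-- The operators of `S` living on the range of a projection of minimal rank form a group of
unitaries. -/
theorem exists_subgroup_unitaryOperators {J : EuclideanSpace ℂ (Fin r) →L[ℂ] H}
    (hJ : J.adjoint ∘L J = 1) (hJP : J ∘L J.adjoint = P)
    (hpi : ∀ A ∈ S, IsPartialIsometry A)
    (hirr : IsIrreducibleFamily (S : Set (H →L[ℂ] H))) (hclosed : IsClosed (S : Set (H →L[ℂ] H)))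
    (hr : IsLeast (nonzeroRanks (S : Set (H →L[ℂ] H))) r)
    (hP : IsStarProjection P) (hPr : P ∈ rankPart S r) :
    ∃ U : Subgroup (Matrix.unitaryGroup (Fin r) ℂ),
      ∀ C, C ∈ unitaryOperators U ↔ C ≠ 0 ∧ corner J C ∈ S := by
  let Φ := Matrix.toEuclideanCLM (n := Fin r) (𝕜 := ℂ)
  have hne {u : Matrix (Fin r) (Fin r) ℂ} (hu : u ∈ Matrix.unitaryGroup (Fin r) ℂ) :
      Φ u ≠ 0 := fun h => by
    have h1 : star (Φ u) * Φ u = 1 := by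
      rw [← map_star, ← map_mul, Matrix.mem_unitaryGroup_iff'.1 hu, map_one]
    refine hPr.2.1 ?_
    rw [← hJP, ← corner_one, ← h1, h, mul_zero]
    simp [corner]
  let U : Subgroup (Matrix.unitaryGroup (Fin r) ℂ) :=
    { carrier := {u | corner J (Φ u) ∈ S}
      mul_mem' := fun {u v} hu hv => by
        change corner J (Φ (u * v : Matrix (Fin r) (Fin r) ℂ)) ∈ S
        rw [map_mul, corner_mul hJ]
        exact S.mul_mem hu hv
      one_mem' := by
        change corner J (Φ 1) ∈ S
        rw [map_one, corner_one, hJP]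
        exact hPr.1
      inv_mem' := fun {u} hu => by
        change corner J (Φ (star (u : Matrix (Fin r) (Fin r) ℂ))) ∈ S
        rw [map_star, corner_star]
        exact (star_mem_rankPart hpi hirr hclosed hr
          (corner_mem_rankPart hJ hJP hr hPr hu (hne u.2))).1 }
  refine ⟨U, fun C => ⟨?_, fun ⟨h0, hC⟩ => ?_⟩⟩
  · rintro ⟨u, hu, rfl⟩
    exact ⟨hne u.2, hu⟩
  · have hT := corner_mem_rankPart hJ hJP hr hPr hC h0
    have hTP : corner J C * P = corner J C := by
      rw [← hJP, ← corner_one, ← corner_mul hJ, mul_one]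
    -- The non-zero product with `P` shows that the initial projection is `P`, i.e. `star C * C =
    -- 1`; for square matrices this is unitarity.
    have h1 := star_mul_self_eq_of_mem_rankPart hpi hr hPr hT (by rw [hTP]; exact hT.2.1)
    rw [hP.isSelfAdjoint.star_eq, hP.isIdempotentElem, ← corner_star, ← corner_mul hJ, ← hJP,
      ← corner_one] at h1
    have h2 := corner_injective hJ h1
    have hΦ : Φ (Φ.symm C) = C := Φ.apply_symm_apply C
    have hu : Φ.symm C ∈ Matrix.unitaryGroup (Fin r) ℂ := by
      refine Matrix.mem_unitaryGroup_iff'.2 (EquivLike.injective Φ ?_)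
      rw [map_mul, map_star, hΦ, h2, map_one]
    refine ⟨⟨Φ.symm C, hu⟩, ?_, hΦ⟩
    change corner J (Φ (Φ.symm C)) ∈ S
    rwa [hΦ]

/-- For non-zero `x` in `M` and `y` orthogonal to `M`, irreducibility of `S` gives `T` whose
compression has a non-zero coefficient between `x` and `y`. It moves `x` out of `M`, and its corner
is `P * T * P`. -/
theorem isIrreducibleFamily_corner {K : Type*} [NormedAddCommGroup K] [InnerProductSpace ℂ K]
    [CompleteSpace K] {J : K →L[ℂ] H} (hJ : J.adjoint ∘L J = 1) (hJP : J ∘L J.adjoint = P)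
    (hirr : IsIrreducibleFamily (S : Set (H →L[ℂ] H))) (hPr : P ∈ rankPart S r) :
    IsIrreducibleFamily {C : K →L[ℂ] K | C ≠ 0 ∧ corner J C ∈ S} := by
  intro M hM hinv
  have hJJ (z : K) : J.adjoint (J z) = z := DFunLike.congr_fun hJ z
  by_contra! hcon
  obtain ⟨x, hx, hx0⟩ := M.ne_bot_iff.1 hcon.1
  have : CompleteSpace M := hM.completeSpace_coe
  have hMo : Mᗮ ≠ ⊥ := fun h => hcon.2 (Submodule.orthogonal_eq_bot_iff.1 h)
  obtain ⟨y, hy, hy0⟩ := Mᗮ.ne_bot_iff.1 hMo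
  have hJ0 {z : K} (hz : z ≠ 0) : J z ≠ 0 := fun h => hz (by rw [← hJJ z, h, map_zero])
  obtain ⟨T, hT, hyT⟩ := exists_apply_ne_zero hirr ⟨P, hPr.1, hPr.2.1⟩
    (C := innerSL ℂ (J y)) (fun h => inner_self_ne_zero.2 (hJ0 hy0)
      (DFunLike.congr_fun h (J y))) (hJ0 hx0)
  have hCx : inner ℂ y ((J.adjoint ∘L T ∘L J) x) ≠ 0 := by
    rw [ContinuousLinearMap.comp_apply, ContinuousLinearMap.adjoint_inner_right]
    exact hyT
  refine hCx (Submodule.inner_left_of_mem_orthogonal (hinv (J.adjoint ∘L T ∘L J) ⟨?_, ?_⟩ x hx) hy)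
  · intro h
    rw [h] at hCx
    simp at hCx
  · have : corner J (J.adjoint ∘L T ∘L J) = P * T * P := by rw [← hJP]; rfl
    rw [this]
    exact S.mul_mem (S.mul_mem hPr.1 hT) hPr.1

end Structure

end PartialIsometrySemigroup

/-! ### Assembly of the theorem -/

open PartialIsometrySemigroup in
theorem theorem3p13 {H : Type*} [NormedAddCommGroup H] [InnerProductSpace ℂ H] [CompleteSpace H]
    [TopologicalSpace.SeparableSpace H]
    (S : Subsemigroup (H →L[ℂ] H))
    (hpi : ∀ A ∈ S, IsPartialIsometry A)
    (hirr : IsIrreducibleFamily (S : Set (H →L[ℂ] H)))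
    (hclosed : IsClosed (S : Set (H →L[ℂ] H)))
    (hcompact : ∃ A ∈ S, A ≠ 0 ∧ IsCompactOperator A) :
    ∃ (k : ℕ∞) (r₀ : ℕ) (U : Subgroup (Matrix.unitaryGroup (Fin r₀) ℂ))
      (W : H ≃ₗᵢ[ℂ] DirectSumSpace (Index k) (EuclideanSpace ℂ (Fin r₀))),
      1 ≤ k ∧
      IsLeast (nonzeroRanks (S : Set (H →L[ℂ] H))) (r₀ : Cardinal) ∧
      IsIrreducibleFamily (unitaryOperators U) ∧
      S₀ k (unitaryOperators U) \ {0} ⊆ conjugate W (S : Set (H →L[ℂ] H)) ∧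
      (¬ (k = 1 ∧ (0 : H →L[ℂ] H) ∉ S) →
        S₀ k (unitaryOperators U) ⊆ conjugate W (S : Set (H →L[ℂ] H))) ∧
      conjugate W (S : Set (H →L[ℂ] H)) ⊆ S₁ k (unitaryOperators U) := by
  classical
  obtain ⟨r, hr⟩ := exists_isLeast_nonzeroRanks hpi hcompact
  obtain ⟨A₀, hA₀⟩ : ∃ A, A ∈ rankPart S r := hr.1
  obtain ⟨P, hPA⟩ : ∃ P, P = A₀ * star A₀ := ⟨_, rfl⟩
  have hP : IsStarProjection P := hPA ▸ (hpi _ hA₀.1).self_mul_star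
  have hPr : P ∈ rankPart S r := hPA ▸ self_mul_star_mem_rankPart hpi hirr hclosed hr hA₀
  obtain ⟨J, hJ, hJP⟩ := exists_isometry_of_isStarProjection hP hPr.2.2
  obtain ⟨k, hk, A, hA, hAP, horth, hex⟩ :=
    exists_orthogonal_family hpi hirr hclosed hr hP hPr
  have hsA (i : Index k) : star (A i) ∈ rankPart S r :=
    star_mem_rankPart hpi hirr hclosed hr (hA i)
  have hAmul (i : Index k) : A i * P = A i :=
    mul_eq_self_of_star_mul_self_eq (hpi _ (hA i).1) (hAP i)
  have hmulA (i : Index k) : P * star (A i) = star (A i) := by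
    simpa [hP.isSelfAdjoint.star_eq] using congrArg star (hAmul i)
  have hinj (i j : Index k) (h : A i * star (A i) = A j * star (A j)) : i = j := by
    by_contra hij
    refine (hA j).2.1 ?_
    rw [← (hpi _ (hA j).1).mul_star_mul, ← h, mul_assoc, horth i j hij, mul_zero]
  have hV₁ (i : Index k) : (A i ∘L J).adjoint ∘L (A i ∘L J) = 1 := by
    rw [adjoint_comp_comp, hAP, adjoint_comp_proj_comp hJ hJP]
  have hV₀ (i j : Index k) (hij : i ≠ j) : (A i ∘L J).adjoint ∘L (A j ∘L J) = 0 := by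
    rw [adjoint_comp_comp, horth i j hij, ContinuousLinearMap.zero_comp,
      ContinuousLinearMap.comp_zero]
  have i₀ : Index k := ⟨0, lt_of_lt_of_le (by simp) hk⟩
  have : Nonempty (Index k) := ⟨i₀⟩
  obtain ⟨W, hW, hW'⟩ := exists_isometryEquiv_directSumSpace hV₁ hV₀
    (topologicalClosure_iSup_range_eq_top hJP hpi hirr hr hA hAP hex)
  obtain ⟨U, hU⟩ := exists_subgroup_unitaryOperators hJ hJP hpi hirr hclosed hr hP hPr
  have hUset : unitaryOperators U = {C | C ≠ 0 ∧ corner J C ∈ S} := Set.ext hU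
  have hmat := isOperatorMatrix_conjStarAlgEquiv hW hW'
  have hcorner (T : H →L[ℂ] H) (i j : Index k) :
      corner J ((A i ∘L J).adjoint ∘L T ∘L (A j ∘L J)) = star (A i) * T * A j := by
    rw [adjoint_comp_comp_comp]
    conv_rhs => rw [← hmulA i, ← hAmul j, ← hJP]
    rfl
  -- The operator with the single block `C` at `(i, j)` is `A i * corner J C * star (A j)`.
  have hblock {C} (hC : C ∈ unitaryOperators U) (i j : Index k) :
      ∃ T ∈ S, IsOperatorMatrix (fun i' j' => if i' = i ∧ j' = j then C else 0)
        (W.conjStarAlgEquiv T) := by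
    refine ⟨A i * corner J C * star (A j),
      S.mul_mem (S.mul_mem (hA i).1 ((hU C).1 hC).2) (hsA j).1, ?_⟩
    intro i' j' x
    refine (hmat _ i' j' x).trans (DFunLike.congr_fun ?_ x)
    change _ = if i' = i ∧ j' = j then C else 0
    have hfac : (A i' ∘L J).adjoint ∘L (A i * corner J C * star (A j)) ∘L (A j' ∘L J)
        = ((A i' ∘L J).adjoint ∘L (A i ∘L J)) ∘L C ∘L
          ((A j ∘L J).adjoint ∘L (A j' ∘L J)) := by
      rw [ContinuousLinearMap.adjoint_comp (A j) J]
      rfl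
    refine hfac.trans ?_
    by_cases hi : i' = i
    · by_cases hj : j' = j
      · subst hi hj
        rw [hV₁, hV₁, if_pos ⟨rfl, rfl⟩]
        rfl
      · rw [hV₀ j j' (Ne.symm hj), if_neg fun h => hj h.2]
        simp
    · rw [hV₀ i' i hi, if_neg fun h => hi h.1]
      simp
  have hS₀ : S₀ k (unitaryOperators U) \ {0} ⊆ conjugate W (S : Set (H →L[ℂ] H)) := by
    rintro T' ⟨⟨B, hB, M, hM, hBM⟩, hT'⟩
    by_cases hex : ∃ i j, M i j ≠ 0
    · obtain ⟨i, j, hij⟩ := hex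
      obtain ⟨T, hT, hTm⟩ := hblock ((hBM i j).2 hij) i j
      refine ⟨T, hT, operator_eq_of_isOperatorMatrix hTm ?_⟩
      intro i' j' x
      refine (hB i' j' x).trans (DFunLike.congr_fun (Eq.symm ?_) x)
      change (if i' = i ∧ j' = j then B i j else 0) = B i' j'
      split_ifs with h
      · rw [h.1, h.2]
      · refine ((hBM i' j').1 ?_).symm
        by_contra h'
        exact h (hM.2 _ _ _ _ h' hij)
    · push Not at hex
      refine (hT' (operator_eq_of_isOperatorMatrix hB fun i j x => ?_)).elim
      rw [(hBM i j).1 (hex i j)]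
      rfl
  refine ⟨k, r, U, W, hk, hr, ?_, hS₀, ?_, ?_⟩
  · rw [hUset]
    exact isIrreducibleFamily_corner hJ hJP hirr hPr
  · intro hexc T' hT'
    by_cases h0 : T' = 0
    · subst h0
      refine ⟨0, ?_, map_zero _⟩
      by_cases hk1 : k = 1
      · by_contra h
        exact hexc ⟨hk1, h⟩
      -- With two orthogonal summands, `0` is the product of `star (A 0)` and `A 1`.
      · have hk2 : (1 : ℕ∞) < k := lt_of_le_of_ne hk (Ne.symm hk1)
        have h01 := horth ⟨0, lt_of_lt_of_le (by simp) hk⟩ ⟨1, by exact_mod_cast hk2⟩ (by simp)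
        exact h01 ▸ S.mul_mem (hsA _).1 (hA _).1
    · exact hS₀ ⟨hT', h0⟩
  · rintro _ ⟨T, hT, rfl⟩
    let B : Matrix (Index k) (Index k)
      (EuclideanSpace ℂ (Fin r) →L[ℂ] EuclideanSpace ℂ (Fin r)) :=
        fun i j => (A i ∘L J).adjoint ∘L T ∘L (A j ∘L J)
    have hne {i j : Index k} (h : B i j ≠ 0) : star (A i) * T * A j ≠ 0 := fun h0 => by
      rw [← hcorner] at h0
      exact h (corner_injective hJ (h0.trans (by simp [corner])))
    let M : Matrix (Index k) (Index k) ℂ := fun i j => if B i j = 0 then 0 else 1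
    have hM {i j : Index k} : M i j ≠ 0 ↔ B i j ≠ 0 := by simp [M]
    refine ⟨B, hmat T, M, ⟨fun i j h => if_neg (hM.1 h), fun i j j' h h' => ?_,
      fun i i' j h h' => ?_⟩, fun i j => ⟨fun h => ?_, fun h => ?_⟩⟩
    -- A non-zero block in row `i` and column `j` makes `A j * star (A j)` the initial projection of
    -- `star (A i) * T`, which determines `j`.
    · have key {j : Index k} (h : M i j ≠ 0) :
          star (star (A i) * T) * (star (A i) * T) = A j * star (A j) :=
        star_mul_self_eq_of_mem_rankPart hpi hr (hA j) (mul_mem_rankPart_of_left hr hT (hsA i)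
          fun h0 => hne (hM.1 h) (by rw [h0, zero_mul])) (hne (hM.1 h))
      exact hinj j j' ((key h).symm.trans (key h'))
    -- Dually, `A i * star (A i)` is the final projection of `T * A j`.
    · have key {i : Index k} (h : M i j ≠ 0) : A i * star (A i) = T * A j * star (T * A j) := by
        have hne' : star (A i) * (T * A j) ≠ 0 := by rw [← mul_assoc]; exact hne (hM.1 h)
        simpa using star_mul_self_eq_of_mem_rankPart hpi hr
          (mul_mem_rankPart_of_right hr hT (hA j) fun h0 => hne' (by rw [h0, mul_zero]))
          (hsA i) hne'
      exact hinj i i' ((key h).trans (key h').symm)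
    · by_contra h0
      exact hM.2 h0 h
    · refine (hU _).2 ⟨hM.1 h, ?_⟩
      rw [hcorner]
      exact S.mul_mem (S.mul_mem (hsA i).1 hT) (hA j).1
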